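/- Let $A$ and $B$ be finite-dimensional Hilbert spaces and let $\log$ denote the logarithm to base $2$. A state is a positive semidefinite operator of trace $1$; a sub-normalized state is an operator $\rho\ge 0$ with $0<\operatorname{tr}\rho\le 1$. For sub-normalized states on the same space define the generalized fidelity and the purified distance $$\bar F(\rho,\tau)=\Big(\|\sqrt{\rho}\sqrt{\tau}\|_1+\sqrt{(1-\operatorname{tr}\rho)(1-\operatorname{tr}\tau)}\Big)^2,\qquad P(\rho,\tau)=\sqrt{1-\bar F(\rho,\tau)},$$ where $\|\cdot\|_1$ is the trace norm. For a sub-normalized state $\rho$ and $\sigma\ge 0$ define the max-divergence, with values in $\mathbb{R}\cup\{+\infty\}$, and for $\eta\in[0,1)$ the smooth max-divergence by $$D_{\max}(\rho\|\sigma)=\inf\{\lambda\in\mathbb{R}:\rho\le 2^{\lambda}\sigma\},\qquad D_{\max}^{\eta}(\rho\|\sigma)=\inf_{\tau}D_{\max}(\tau\|\sigma),$$ where $\le$ between operators is the Löwner order, $\inf\emptyset=+\infty$, and the second infimum runs over all sub-normalized states $\tau$ with $P(\rho,\tau)\le\eta$. **Corollary (joint smoothing with smooth max-divergences).** Let $\rho_{AB}$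 be a state on $A\otimes B$ with marginals $\rho_A$ and $\rho_B$, and let $\sigma_A\ge 0$ and $\sigma_B\ge 0$ be positive semidefinite operators on $A$ and $B$, respectively. For any $\varepsilon,\varepsilon',\delta\in(0,1)$ with $\varepsilon+\varepsilon'+2\delta<1$ there exists a state $\tilde\rho_{AB}$ on $A\otimes B$ with $$P(\rho_{AB},\tilde\rho_{AB})\le\sqrt{\varepsilon+\varepsilon'+2\delta}$$ whose marginals $\tilde\rho_A$ and $\tilde\rho_B$ satisfy $$D_{\max}(\tilde\rho_A\|\sigma_A)\le D_{\max}^{\sqrt{\varepsilon}}(\rho_A\|\sigma_A)+\Delta\quad\text{and}\quad D_{\max}(\tilde\rho_B\|\sigma_B)\le D_{\max}^{\sqrt{\varepsilon'}}(\rho_B\|\sigma_B)+\Delta,$$ where $\Delta=2-2\log\delta-\log(1-\varepsilon-\varepsilon'-2\delta)$. -/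

import Mathlib

open scoped ComplexOrder MatrixOrder

namespace OneShot

noncomputable section

variable {n a b : Type*} [Fintype n] [DecidableEq n] [Fintype a] [Fintype b]

/-- A (trace-normalized) quantum state on the Hilbert space `ℂⁿ`. -/
def IsState (ρ : Matrix n n ℂ) : Prop :=
  ρ.PosSemidef ∧ ρ.trace = 1

/-- A sub-normalized state on `ℂⁿ`: positive semidefinite with `0 < tr ρ ≤ 1`
(the trace of a positive semidefinite operator is real). -/
def IsSubnormalizedState (ρ : Matrix n n ℂ) : Prop :=
  ρ.PosSemidef ∧ 0 < ρ.trace.re ∧ ρ.trace.re ≤ 1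

/-- The marginal on `A` of an operator on `A ⊗ B = ℂ^(a × b)`, i.e. the partial trace over `B`. -/
def marginalA (X : Matrix (a × b) (a × b) ℂ) : Matrix a a ℂ :=
  Matrix.of fun i j => ∑ k : b, X (i, k) (j, k)

/-- The marginal on `B` of an operator on `A ⊗ B = ℂ^(a × b)`, i.e. the partial trace over `A`. -/
def marginalB (X : Matrix (a × b) (a × b) ℂ) : Matrix b b ℂ :=
  Matrix.of fun i j => ∑ k : a, X (k, i) (k, j)

/-- The trace norm `‖X‖₁ = tr √(X* X)`. -/
def traceNorm (X : Matrix n n ℂ) : ℝ :=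
  (CFC.sqrt (star X * X)).trace.re

/-- The generalized fidelity
`F(ρ, σ) = (‖√ρ √σ‖₁ + √((1 - tr ρ) (1 - tr σ)))²` of sub-normalized states. -/
def genFidelity (ρ σ : Matrix n n ℂ) : ℝ :=
  (traceNorm (CFC.sqrt ρ * CFC.sqrt σ) +
    Real.sqrt ((1 - ρ.trace.re) * (1 - σ.trace.re))) ^ 2

/-- The purified distance `P(ρ, σ) = √(1 - F(ρ, σ))`. -/
def purifiedDist (ρ σ : Matrix n n ℂ) : ℝ :=
  Real.sqrt (1 - genFidelity ρ σ)

/-- The neighbourhood of sub-normalized states that are `ε`-close to `ρ` in purified distance. -/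
def purifiedBall (ε : ℝ) (ρ : Matrix n n ℂ) : Set (Matrix n n ℂ) :=
  {τ | IsSubnormalizedState τ ∧ purifiedDist ρ τ ≤ ε}

/-- The max-divergence `inf {l : ℝ | ρ ≤ 2 ^ l σ}` with respect to the Löwner order; it is `+∞` when
there is no such `l`. -/
def dMax (ρ σ : Matrix n n ℂ) : EReal :=
  ⨅ (l : ℝ) (_ : ρ ≤ ((2 : ℝ) ^ l) • σ), (l : EReal)

/-- The smooth max-divergence, with smoothing in purified distance. -/
def smoothDMax (ε : ℝ) (ρ σ : Matrix n n ℂ) : EReal :=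
  ⨅ τ ∈ purifiedBall ε ρ, dMax τ σ

end

end OneShot

/-! Take near-optimal `α`, `β` in the balls around the two marginals. Writing `η = ε + ε' + 2δ`, it
suffices to find one state `τ` close to `ρ` whose marginals are at most `kα` and `kβ`, with `k =
1/(δ²(1 - η))`; the logarithm of `k` goes into the additive constant.

A Löwner inequality is a family of scalar inequalities, one for each test operator `W ≥ 0`, so a
minimax argument (`exists_state_marginals_le`) allows `τ` to depend on the pair `(W, W')`. For a
fixed pair, `exists_projection` measures in the eigenbasis of `W` and discards the outcomes where
the weight `q` of `α` is below `δ²` times the weight `p` of the marginal. Monotonicity of fidelity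
under measurement bounds the discarded mass by `ε + δ`. Projecting `ρ` with `P ⊗ Q` keeps mass `t ≥
1 - η`, and the renormalised state has fidelity `t` with `ρ`.

Minimax needs a compact convex set and an affine payoff. Carrying a matrix `V` with `VV* ≤ τ` makes
the fidelity constraint linear in `V`. -/

namespace OneShot

open scoped Matrix Kronecker
open Matrix

/-! ### Polar decomposition, trace norm and fidelity -/

section MatrixLemmas

variable {n : Type*} [Fintype n] [DecidableEq n]

/-- Two square matrices with the same Gram matrix differ by a unitary on the left. -/
theorem exists_unitary_mul_eq {A B : Matrix n n ℂ} (h : Aᴴ * A = Bᴴ * B) :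
    ∃ U : Matrix n n ℂ, Uᴴ * U = 1 ∧ A = U * B := by
  set f := toEuclideanLin A with hf
  set g := toEuclideanLin B with hg
  have key : LinearMap.adjoint f ∘ₗ f = LinearMap.adjoint g ∘ₗ g := by
    rw [hf, hg, ← toEuclideanLin_conjTranspose_eq_adjoint,
      ← toEuclideanLin_conjTranspose_eq_adjoint]
    ext x : 1
    simp only [LinearMap.comp_apply, toLpLin_apply, mulVec_mulVec, h]
  have hnorm (x) : ‖f x‖ = ‖g x‖ := by
    have h1 : inner ℂ (f x) (f x) = inner ℂ (g x) (g x) := by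
      rw [← LinearMap.adjoint_inner_right, ← LinearMap.adjoint_inner_right]
      exact congrArg (inner ℂ x) (LinearMap.congr_fun key x)
    rw [inner_self_eq_norm_sq_to_K, inner_self_eq_norm_sq_to_K] at h1
    have h2 : ‖f x‖ ^ 2 = ‖g x‖ ^ 2 := by exact_mod_cast h1
    exact (sq_eq_sq₀ (norm_nonneg _) (norm_nonneg _)).1 h2
  have hker : LinearMap.ker g ≤ LinearMap.ker f := fun x hx => by
    rw [LinearMap.mem_ker] at hx ⊢
    rw [← norm_eq_zero, hnorm, hx, norm_zero]
  -- `g x ↦ f x` is a well-defined isometry on the range of `g`; in finite dimension it extends to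
  -- an isometry of the whole space.
  let l : LinearMap.range g →ₗ[ℂ] EuclideanSpace ℂ n :=
    ((LinearMap.ker g).liftQ f hker) ∘ₗ g.quotKerEquivRange.symm.toLinearMap
  have hl (x) : l ⟨g x, LinearMap.mem_range_self g x⟩ = f x := by
    simp [l]
  have hln (y : LinearMap.range g) : ‖l y‖ = ‖y‖ := by
    obtain ⟨_, x, rfl⟩ := y
    exact (congrArg norm (hl x)).trans (hnorm x)
  let L : LinearMap.range g →ₗᵢ[ℂ] EuclideanSpace ℂ n := ⟨l, hln⟩
  let u := L.extend.toLinearMap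
  refine ⟨toEuclideanLin.symm u, ?_, ?_⟩
  · apply toEuclideanLin.injective
    ext x : 1
    have h1 : toEuclideanLin ((toEuclideanLin.symm u)ᴴ * toEuclideanLin.symm u) x =
        LinearMap.adjoint u (u x) := by
      conv_rhs => rw [← toEuclideanLin.apply_symm_apply u]
      rw [← toEuclideanLin_conjTranspose_eq_adjoint]
      simp only [toLpLin_apply, mulVec_mulVec]
    rw [h1]
    refine ext_inner_left ℂ fun v => ?_
    rw [LinearMap.adjoint_inner_right]
    refine (L.extend.inner_map_map v x).trans ?_
    simp
  · apply toEuclideanLin.injective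
    ext x : 1
    have h1 : toEuclideanLin (toEuclideanLin.symm u * B) x = u (g x) := by
      conv_rhs => rw [← toEuclideanLin.apply_symm_apply u]
      rw [hg]
      simp only [toLpLin_apply, mulVec_mulVec]
    rw [h1]
    exact ((L.extend_apply ⟨g x, LinearMap.mem_range_self g x⟩).trans (hl x)).symm

/-- The trace of a product of two positive semidefinite matrices is nonnegative. -/
theorem trace_mul_re_nonneg {A B : Matrix n n ℂ} (hA : A.PosSemidef) (hB : B.PosSemidef) :
    0 ≤ (A * B).trace.re := by
  obtain ⟨C, rfl⟩ := CStarAlgebra.nonneg_iff_eq_star_mul_self.mp hB.nonneg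
  rw [star_eq_conjTranspose, ← Matrix.mul_assoc, trace_mul_comm, ← Matrix.mul_assoc]
  exact (Complex.nonneg_iff.1 (hA.mul_mul_conjTranspose_same C).trace_nonneg).1

/-- Cauchy-Schwarz for the Hilbert-Schmidt inner product. -/
theorem trace_conjTranspose_mul_re_le {n m : Type*} [Fintype n] [Fintype m] (A B : Matrix m n ℂ) :
    (Aᴴ * B).trace.re ≤ √(Aᴴ * A).trace.re * √(Bᴴ * B).trace.re := by
  have hsq (C : Matrix m n ℂ) : (Cᴴ * C).trace.re = ∑ p : n × m, ‖C p.2 p.1‖ ^ 2 := by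
    rw [Fintype.sum_prod_type]
    simp only [trace, diag, mul_apply, conjTranspose_apply, Complex.re_sum]
    refine Finset.sum_congr rfl fun i _ => Finset.sum_congr rfl fun j _ => ?_
    rw [RCLike.star_def, ← Complex.normSq_eq_conj_mul_self, Complex.ofReal_re,
      Complex.normSq_eq_norm_sq]
  rw [hsq, hsq]
  refine le_trans ?_ (Real.sum_mul_le_sqrt_mul_sqrt _ _ _)
  rw [Fintype.sum_prod_type]
  simp only [trace, diag, mul_apply, conjTranspose_apply, Complex.re_sum]
  refine Finset.sum_le_sum fun i _ => Finset.sum_le_sum fun j _ => ?_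
  refine (Complex.re_le_norm _).trans ?_
  rw [norm_mul, norm_star]

/-- With `A = C*C`, this is Cauchy-Schwarz for `CU*` and `C`, whose squared Hilbert-Schmidt norms
both equal `tr A`. -/
theorem unitary_trace_mul_re_le {U A : Matrix n n ℂ} (hU : Uᴴ * U = 1) (hA : A.PosSemidef) :
    (U * A).trace.re ≤ A.trace.re := by
  obtain ⟨C, rfl⟩ := CStarAlgebra.nonneg_iff_eq_star_mul_self.mp hA.nonneg
  rw [star_eq_conjTranspose]
  have h := trace_conjTranspose_mul_re_le (C * Uᴴ) C
  have h0 : 0 ≤ (Cᴴ * C).trace.re :=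
    (Complex.nonneg_iff.1 (posSemidef_conjTranspose_mul_self C).trace_nonneg).1
  have h1 : ((C * Uᴴ)ᴴ * (C * Uᴴ)).trace = (Cᴴ * C).trace := by
    rw [conjTranspose_mul, conjTranspose_conjTranspose, trace_mul_comm, ← Matrix.mul_assoc,
      Matrix.mul_assoc C, hU, Matrix.mul_one, trace_mul_comm]
  rw [h1, Real.mul_self_sqrt h0, conjTranspose_mul, conjTranspose_conjTranspose,
    Matrix.mul_assoc] at h
  exact h

/-- The polar decomposition of a square matrix. -/
theorem exists_polar_decomposition (X : Matrix n n ℂ) :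
    ∃ U : Matrix n n ℂ, Uᴴ * U = 1 ∧ X = U * CFC.sqrt (star X * X) := by
  refine exists_unitary_mul_eq ?_
  have h := (CFC.sqrt_nonneg (star X * X)).posSemidef.isHermitian
  rw [h.eq, CFC.sqrt_mul_sqrt_self _ (star_mul_self_nonneg X), star_eq_conjTranspose]

/-- The variational characterization of the trace norm: the maximum is attained. -/
theorem exists_unitary_traceNorm_eq (X : Matrix n n ℂ) :
    ∃ U : Matrix n n ℂ, Uᴴ * U = 1 ∧ traceNorm X = (U * X).trace.re := by
  obtain ⟨U, hU, h⟩ := exists_polar_decomposition X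
  refine ⟨Uᴴ, by rw [conjTranspose_conjTranspose, mul_eq_one_comm.1 hU], ?_⟩
  conv_rhs => rw [h, ← Matrix.mul_assoc, hU, Matrix.one_mul]
  rfl

/-- The variational characterization of the trace norm: the upper bound. -/
theorem unitary_trace_mul_re_le_traceNorm {U : Matrix n n ℂ} (hU : Uᴴ * U = 1)
    (X : Matrix n n ℂ) : (U * X).trace.re ≤ traceNorm X := by
  obtain ⟨V, hV, h⟩ := exists_polar_decomposition X
  conv_lhs => rw [h, ← Matrix.mul_assoc]
  refine unitary_trace_mul_re_le ?_ (CFC.sqrt_nonneg _).posSemidef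
  rw [conjTranspose_mul, Matrix.mul_assoc, ← Matrix.mul_assoc Uᴴ, hU, Matrix.one_mul, hV]

theorem traceNorm_conjTranspose_le (X : Matrix n n ℂ) : traceNorm Xᴴ ≤ traceNorm X := by
  obtain ⟨U, hU, h⟩ := exists_unitary_traceNorm_eq Xᴴ
  have hU' : Uᴴᴴ * Uᴴ = 1 := by rw [conjTranspose_conjTranspose, mul_eq_one_comm.1 hU]
  refine le_trans (le_of_eq ?_) (unitary_trace_mul_re_le_traceNorm hU' X)
  rw [h, trace_mul_comm Uᴴ, ← conjTranspose_conjTranspose (U * Xᴴ), trace_conjTranspose,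
    conjTranspose_mul, conjTranspose_conjTranspose, RCLike.star_def, Complex.conj_re]

/-- Operator monotonicity of the square root. -/
theorem traceNorm_mono {X Y : Matrix n n ℂ} (h : Xᴴ * X ≤ Yᴴ * Y) :
    traceNorm X ≤ traceNorm Y := by
  open scoped Matrix.Norms.L2Operator in
  have := (Complex.nonneg_iff.1
    (CFC.sqrt_le_sqrt _ _ h : CFC.sqrt (star X * X) ≤ CFC.sqrt (star Y * Y)).trace_nonneg).1
  rw [trace_sub, Complex.sub_re] at this
  exact sub_nonneg.1 this

/-- If `V V* ≤ τ`, then `V` witnesses a lower bound on the fidelity with `τ`. -/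
theorem trace_sqrt_mul_re_le_traceNorm {ρ τ V : Matrix n n ℂ} (hτ : τ.PosSemidef)
    (hV : (τ - V * Vᴴ).PosSemidef) :
    (CFC.sqrt ρ * V).trace.re ≤ traceNorm (CFC.sqrt ρ * CFC.sqrt τ) := by
  set S := CFC.sqrt ρ
  have hS : Sᴴ = S := (CFC.sqrt_nonneg ρ).posSemidef.isHermitian.eq
  have hT : (CFC.sqrt τ)ᴴ = CFC.sqrt τ := (CFC.sqrt_nonneg τ).posSemidef.isHermitian.eq
  have h1 := unitary_trace_mul_re_le_traceNorm (U := (1 : Matrix n n ℂ)) (by simp) (S * V)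
  rw [Matrix.one_mul] at h1
  -- Pass to adjoints: conjugating `VV* ≤ τ` by `S` compares the Gram matrices of `(SV)*` and
  -- `(S√τ)*`.
  have h2 := traceNorm_conjTranspose_le (S * V)ᴴ
  rw [conjTranspose_conjTranspose] at h2
  have h3 : traceNorm (S * V)ᴴ ≤ traceNorm (S * CFC.sqrt τ)ᴴ := by
    refine traceNorm_mono ?_
    rw [le_iff, conjTranspose_conjTranspose, conjTranspose_conjTranspose]
    have : S * CFC.sqrt τ * (S * CFC.sqrt τ)ᴴ - S * V * (S * V)ᴴ = S * (τ - V * Vᴴ) * Sᴴ := by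
      conv_rhs => rw [← CFC.sqrt_mul_sqrt_self τ hτ.nonneg]
      simp only [conjTranspose_mul, hT, Matrix.mul_sub, Matrix.sub_mul, Matrix.mul_assoc]
    rw [this]
    exact hV.mul_mul_conjTranspose_same S
  exact h1.trans (h2.trans (h3.trans (traceNorm_conjTranspose_le _)))

/-- The fidelity does not decrease under a projective measurement. -/
theorem traceNorm_sqrt_mul_sqrt_le {ρ α P : Matrix n n ℂ} (hρ : ρ.PosSemidef)
    (hα : α.PosSemidef) (hP : P.IsHermitian) (hPP : P * P = P) :
    traceNorm (CFC.sqrt ρ * CFC.sqrt α) ≤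
      √(P * ρ).trace.re * √(P * α).trace.re +
        √((1 - P) * ρ).trace.re * √((1 - P) * α).trace.re := by
  set S := CFC.sqrt ρ with hSdef
  set T := CFC.sqrt α with hTdef
  have hS : Sᴴ = S := (CFC.sqrt_nonneg ρ).posSemidef.isHermitian.eq
  have hT : Tᴴ = T := (CFC.sqrt_nonneg α).posSemidef.isHermitian.eq
  have hSS : S * S = ρ := CFC.sqrt_mul_sqrt_self ρ hρ.nonneg
  have hTT : T * T = α := CFC.sqrt_mul_sqrt_self α hα.nonneg
  obtain ⟨U, hU, h⟩ := exists_unitary_traceNorm_eq (S * T)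
  have hU' : U * Uᴴ = 1 := mul_eq_one_comm.1 hU
  have key (Q : Matrix n n ℂ) (hQ : Qᴴ = Q) (hQQ : Q * Q = Q) :
      (U * (S * Q * T)).trace.re ≤ √(Q * ρ).trace.re * √(Q * α).trace.re := by
    have h1 := trace_conjTranspose_mul_re_le (Q * S * Uᴴ) (Q * T)
    have e1 : (Q * S * Uᴴ)ᴴ * (Q * T) = U * (S * Q * T) := by
      simp only [conjTranspose_mul, conjTranspose_conjTranspose, hQ, hS, Matrix.mul_assoc]
      rw [← Matrix.mul_assoc Q Q, hQQ]
    have e2 : ((Q * S * Uᴴ)ᴴ * (Q * S * Uᴴ)).trace = (Q * ρ).trace := by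
      rw [trace_mul_comm]
      simp only [conjTranspose_mul, conjTranspose_conjTranspose, hQ, hS, Matrix.mul_assoc]
      rw [← Matrix.mul_assoc Uᴴ, hU, Matrix.one_mul, ← Matrix.mul_assoc S, hSS,
        trace_mul_comm, Matrix.mul_assoc, hQQ, trace_mul_comm]
    have e3 : ((Q * T)ᴴ * (Q * T)).trace = (Q * α).trace := by
      rw [trace_mul_comm]
      simp only [conjTranspose_mul, hQ, hT, Matrix.mul_assoc]
      rw [← Matrix.mul_assoc T, hTT, trace_mul_comm, Matrix.mul_assoc, hQQ, trace_mul_comm]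
    rwa [e1, e2, e3] at h1
  have h1 := key P hP.eq hPP
  have h2 := key (1 - P) (by rw [conjTranspose_sub, conjTranspose_one, hP.eq])
    (by simp [Matrix.mul_sub, Matrix.sub_mul, hPP])
  have e : U * (S * T) = U * (S * P * T) + U * (S * (1 - P) * T) := by
    rw [← Matrix.mul_add, ← Matrix.add_mul, ← Matrix.mul_add, add_sub_cancel, Matrix.mul_one]
  rw [h, e, trace_add, Complex.add_re]
  exact add_le_add h1 h2

end MatrixLemmas

/-! ### Minimax -/

section Minimax

/-- A consequence of Sion's minimax theorem: if every `y` has an `x` with `f x y ≤ t`, then a single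
`x` works for all `y`. -/
theorem exists_forall_le_of_forall_exists_le {E F : Type*}
    [TopologicalSpace E] [AddCommGroup E] [Module ℝ E] [IsTopologicalAddGroup E]
    [ContinuousSMul ℝ E] [TopologicalSpace F] [AddCommGroup F] [Module ℝ F]
    [IsTopologicalAddGroup F] [ContinuousSMul ℝ F] {X : Set E} {Y : Set F} {f : E → F → ℝ}
    (hY : Y.Nonempty) (cX : Convex ℝ X) (kX : IsCompact X) (cY : Convex ℝ Y)
    (hfx : ∀ x, Continuous (f x)) (hfy : ∀ y, Continuous fun x => f x y)
    (hfx' : ∀ x ∈ X, ConcaveOn ℝ Y (f x)) (hfy' : ∀ y ∈ Y, ConvexOn ℝ X fun x => f x y)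
    {t : ℝ} (h : ∀ y ∈ Y, ∃ x ∈ X, f x y ≤ t) :
    ∃ x ∈ X, ∀ y ∈ Y, f x y ≤ t := by
  by_contra! hcon
  -- Compactness leaves finitely many `y` that together defeat every `x`; the finite form of Sion's
  -- theorem merges them into a single one.
  obtain ⟨s, hs⟩ := kX.elim_finite_subcover (fun y : Y => {x | t < f x y})
    (fun y => isOpen_lt continuous_const (hfy y)) fun x hx => by
      obtain ⟨y, hy, hxy⟩ := hcon x hx
      exact Set.mem_iUnion.2 ⟨⟨y, hy⟩, hxy⟩
  have neX : X.Nonempty := by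
    obtain ⟨y, hy⟩ := hY
    obtain ⟨x, hx, -⟩ := h y hy
    exact ⟨x, hx⟩
  obtain ⟨y, hy, hlt⟩ := Sion.exists_lt_iInf_of_lt_iInf_of_finite (f := f) (t := t)
    (s := Subtype.val '' (s : Set Y)) neX kX
    (fun y _ => (hfy y).lowerSemicontinuous.lowerSemicontinuousOn _)
    (fun y hy => (hfy' y hy).quasiconvexOn) cY
    (fun x _ => (hfx x).upperSemicontinuous.upperSemicontinuousOn _)
    (fun x hx => (hfx' x hx).quasiconcaveOn) cX
    (s.finite_toSet.image _) (by rintro _ ⟨y, -, rfl⟩; exact y.2) (fun x hx => by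
      obtain ⟨y, hys, hxy⟩ := Set.mem_iUnion₂.1 (hs hx)
      exact ⟨y, ⟨y, hys, rfl⟩, hxy⟩)
  obtain ⟨x, hx, hle⟩ := h y hy
  exact absurd (hlt x hx) (not_lt.2 hle)

end Minimax

/-! ### Partial traces -/

section Marginals

variable {a b : Type*}

theorem trace_mul_marginalA [Fintype a] [Fintype b] [DecidableEq b] (M : Matrix a a ℂ) (X : Matrix (a × b) (a × b) ℂ) :
    (M * marginalA X).trace = ((M ⊗ₖ (1 : Matrix b b ℂ)) * X).trace := by
  simp only [trace, diag, mul_apply, marginalA, of_apply, kroneckerMap_apply,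
    Fintype.sum_prod_type, one_apply, mul_ite, mul_one, mul_zero, ite_mul, zero_mul,
    Finset.sum_ite_eq, Finset.mem_univ, if_true, Finset.mul_sum]
  exact Finset.sum_congr rfl fun i _ => Finset.sum_comm

theorem trace_mul_marginalB [Fintype a] [Fintype b] [DecidableEq a] (M : Matrix b b ℂ) (X : Matrix (a × b) (a × b) ℂ) :
    (M * marginalB X).trace = (((1 : Matrix a a ℂ) ⊗ₖ M) * X).trace := by
  simp only [trace, diag, mul_apply, marginalB, of_apply, kroneckerMap_apply,
    Fintype.sum_prod_type_right, one_apply, ite_mul, one_mul, zero_mul,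
    Finset.sum_ite_eq, Finset.mem_univ, if_true, Finset.mul_sum]
  exact Finset.sum_congr rfl fun i _ => Finset.sum_comm

theorem trace_marginalA [Fintype a] [Fintype b] (X : Matrix (a × b) (a × b) ℂ) : (marginalA X).trace = X.trace := by
  simp [trace, marginalA, Fintype.sum_prod_type]

theorem trace_marginalB [Fintype a] [Fintype b] (X : Matrix (a × b) (a × b) ℂ) : (marginalB X).trace = X.trace := by
  simp only [trace, diag, marginalB, of_apply, Fintype.sum_prod_type]
  exact Finset.sum_comm

theorem marginalA_eq_sum_submatrix [Fintype b] (X : Matrix (a × b) (a × b) ℂ) :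
    marginalA X = ∑ k : b, X.submatrix (fun i => (i, k)) (fun i => (i, k)) := by
  ext i j
  simp [marginalA, Matrix.sum_apply]

theorem marginalB_eq_sum_submatrix [Fintype a] (X : Matrix (a × b) (a × b) ℂ) :
    marginalB X = ∑ k : a, X.submatrix (fun i => (k, i)) (fun i => (k, i)) := by
  ext i j
  simp [marginalB, Matrix.sum_apply]

theorem posSemidef_marginalA [Fintype b] {X : Matrix (a × b) (a × b) ℂ} (hX : X.PosSemidef) :
    (marginalA X).PosSemidef := by
  rw [marginalA_eq_sum_submatrix]
  exact posSemidef_sum _ fun _ _ => hX.submatrix _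

theorem posSemidef_marginalB [Fintype a] {X : Matrix (a × b) (a × b) ℂ} (hX : X.PosSemidef) :
    (marginalB X).PosSemidef := by
  rw [marginalB_eq_sum_submatrix]
  exact posSemidef_sum _ fun _ _ => hX.submatrix _

theorem continuous_marginalA [Fintype b] :
    Continuous (marginalA : Matrix (a × b) (a × b) ℂ → Matrix a a ℂ) := by
  refine continuous_matrix fun i j => ?_
  simp only [marginalA, of_apply]
  fun_prop

theorem continuous_marginalB [Fintype a] :
    Continuous (marginalB : Matrix (a × b) (a × b) ℂ → Matrix b b ℂ) := by
  refine continuous_matrix fun i j => ?_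
  simp only [marginalB, of_apply]
  fun_prop

theorem marginalA_combo [Fintype b] (r s : ℝ) (X Y : Matrix (a × b) (a × b) ℂ) :
    marginalA (r • X + s • Y) = r • marginalA X + s • marginalA Y := by
  ext i j
  simp [marginalA, Finset.sum_add_distrib, Finset.mul_sum]

theorem marginalB_combo [Fintype a] (r s : ℝ) (X Y : Matrix (a × b) (a × b) ℂ) :
    marginalB (r • X + s • Y) = r • marginalB X + s • marginalB Y := by
  ext i j
  simp [marginalB, Finset.sum_add_distrib, Finset.mul_sum]

end Marginals

/-! ### Fidelity of two-outcome distributions -/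

section Scalar

/-- Put `p = cos²θ` and `q = cos²φ`, so that the squared expression is `cos²(θ - φ)`. Then `cos²(θ -
φ) - sin²θ = cos φ cos(2θ - φ) ≤ cos φ`. -/
theorem le_add_sqrt_of_fidelity {p q ε : ℝ} (hp0 : 0 ≤ p) (hp1 : p ≤ 1) (hq0 : 0 ≤ q)
    (hq1 : q ≤ 1) (h : 1 - ε ≤ (√p * √q + √(1 - p) * √(1 - q)) ^ 2) : p ≤ ε + √q := by
  set x := √p
  set y := √q
  set X := √(1 - p)
  set Y := √(1 - q)
  have hx : x ^ 2 = p := Real.sq_sqrt hp0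
  have hX : X ^ 2 = 1 - p := Real.sq_sqrt (by linarith)
  have hy : y ^ 2 = q := Real.sq_sqrt hq0
  have hY : Y ^ 2 = 1 - q := Real.sq_sqrt (by linarith)
  have y0 : 0 ≤ y := Real.sqrt_nonneg _
  have e1 : (x ^ 2 - X ^ 2) ^ 2 + (2 * x * X) ^ 2 = 1 := by
    have : x ^ 2 + X ^ 2 = 1 := by linarith
    linear_combination (x ^ 2 + X ^ 2 + 1) * this
  have e2 : y ^ 2 + Y ^ 2 = 1 := by linarith
  have e3 : (x ^ 2 - X ^ 2) * y + 2 * x * X * Y ≤ 1 := by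
    nlinarith [sq_nonneg (x ^ 2 - X ^ 2 - y), sq_nonneg (2 * x * X - Y)]
  have e4 : (x * y + X * Y) ^ 2 - X ^ 2 = y * ((x ^ 2 - X ^ 2) * y + 2 * x * X * Y) := by
    linear_combination X ^ 2 * e2
  nlinarith [mul_le_mul_of_nonneg_left e3 y0]

end Scalar

/-! ### Spectral projections obtained from closeness in purified distance -/

section Projection

variable {n : Type*} [Fintype n] [DecidableEq n]

theorem traceNorm_nonneg (X : Matrix n n ℂ) : 0 ≤ traceNorm X :=
  (Complex.nonneg_iff.1 (CFC.sqrt_nonneg (star X * X)).posSemidef.trace_nonneg).1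

theorem purifiedDist_le_sqrt_iff {ρ α : Matrix n n ℂ} {ε : ℝ} (hρ : ρ.trace = 1) (hε : 0 ≤ ε) :
    purifiedDist ρ α ≤ √ε ↔ 1 - ε ≤ traceNorm (CFC.sqrt ρ * CFC.sqrt α) ^ 2 := by
  rw [purifiedDist, Real.sqrt_le_sqrt_iff hε, genFidelity, hρ]
  simp only [Complex.one_re, sub_self, zero_mul, Real.sqrt_zero, add_zero]
  constructor <;> intro h <;> linarith

theorem trace_re_nonneg {n : Type*} [Fintype n] {X : Matrix n n ℂ} (hX : X.PosSemidef) : 0 ≤ X.trace.re :=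
  (Complex.nonneg_iff.1 hX.trace_nonneg).1

theorem posSemidef_of_projection {n : Type*} [Fintype n] {P : Matrix n n ℂ} (hP : P.IsHermitian) (hPP : P * P = P) :
    P.PosSemidef := by
  have := posSemidef_conjTranspose_mul_self P
  rwa [hP.eq, hPP] at this

theorem posSemidef_one_sub_of_projection {P : Matrix n n ℂ} (hP : P.IsHermitian)
    (hPP : P * P = P) : (1 - P).PosSemidef :=
  posSemidef_of_projection (isHermitian_one.sub hP) (by simp [Matrix.mul_sub, Matrix.sub_mul, hPP])

/-- A projective test that fails with small probability on `α` also does so on states close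
to `α`. -/
theorem trace_projection_le {ρ α Q : Matrix n n ℂ} {ε : ℝ} (hε : 0 ≤ ε) (hρ : IsState ρ)
    (hα : IsSubnormalizedState α) (hd : purifiedDist ρ α ≤ √ε) (hQ : Q.IsHermitian)
    (hQQ : Q * Q = Q) : (Q * ρ).trace.re ≤ ε + √(Q * α).trace.re := by
  have hQ0 := posSemidef_of_projection hQ hQQ
  have hQ1 := posSemidef_one_sub_of_projection hQ hQQ
  have h1 := traceNorm_sqrt_mul_sqrt_le hρ.1 hα.1 hQ hQQ
  have ρ1 : ((1 - Q) * ρ).trace.re = 1 - (Q * ρ).trace.re := by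
    rw [Matrix.sub_mul, Matrix.one_mul, trace_sub, hρ.2]; simp
  have α1 : ((1 - Q) * α).trace.re ≤ 1 - (Q * α).trace.re := by
    rw [Matrix.sub_mul, Matrix.one_mul, trace_sub, Complex.sub_re]
    linarith [hα.2.2]
  have b1 := trace_mul_re_nonneg hQ0 hρ.1
  have b2 := trace_mul_re_nonneg hQ0 hα.1
  have b3 := trace_mul_re_nonneg hQ1 hρ.1
  have b4 := trace_mul_re_nonneg hQ1 hα.1
  refine le_add_sqrt_of_fidelity b1 (by linarith) b2 (by linarith) ?_
  refine ((purifiedDist_le_sqrt_iff hρ.2 hε).1 hd).trans ?_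
  refine pow_le_pow_left₀ (traceNorm_nonneg _) (h1.trans ?_) 2
  rw [ρ1]
  gcongr

theorem trace_conj_diagonal_mul_re (U X : Matrix n n ℂ) (c : n → ℝ) :
    (U * diagonal (fun i => (c i : ℂ)) * Uᴴ * X).trace.re = ∑ i, c i * ((Uᴴ * X * U) i i).re := by
  have : (U * diagonal (fun i => (c i : ℂ)) * Uᴴ * X).trace =
      (diagonal (fun i => (c i : ℂ)) * (Uᴴ * X * U)).trace := by
    rw [Matrix.mul_assoc, Matrix.mul_assoc, trace_mul_comm]
    simp only [Matrix.mul_assoc]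
  rw [this]
  simp [trace, diagonal_mul]

/-- For a state `ρ` close to `α` and any observable `W ≥ 0`, a spectral projection of `W` that `ρ`
passes with high probability and after which `W` is bounded by its expectation under `α`. -/
theorem exists_projection {ρ α W : Matrix n n ℂ} {ε δ : ℝ} (hε : 0 ≤ ε) (hδ : 0 < δ)
    (hρ : IsState ρ) (hα : IsSubnormalizedState α) (hd : purifiedDist ρ α ≤ √ε)
    (hW : W.PosSemidef) :
    ∃ P : Matrix n n ℂ, P.IsHermitian ∧ P * P = P ∧ 1 - ε - δ ≤ (P * ρ).trace.re ∧
      δ ^ 2 * (P * W * P * ρ).trace.re ≤ (W * α).trace.re := by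
  set U : Matrix n n ℂ := hW.1.eigenvectorUnitary.val
  have hU : Uᴴ * U = 1 := Unitary.coe_star_mul_self hW.1.eigenvectorUnitary
  have hU' : U * Uᴴ = 1 := mul_eq_one_comm.1 hU
  let D (c : n → ℝ) : Matrix n n ℂ := U * diagonal (fun i => (c i : ℂ)) * Uᴴ
  have hD (c : n → ℝ) : (D c).IsHermitian := by
    simp only [D, IsHermitian, conjTranspose_mul, conjTranspose_conjTranspose,
      diagonal_conjTranspose, Matrix.mul_assoc]
    congr 3
    ext i
    simp
  have hDD (c d : n → ℝ) : D c * D d = D (fun i => c i * d i) := by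
    simp only [D, Matrix.mul_assoc]
    rw [← Matrix.mul_assoc Uᴴ U, hU, Matrix.one_mul, ← Matrix.mul_assoc (diagonal _) (diagonal _),
      diagonal_mul_diagonal]
    simp
  have hD1 (c : n → ℝ) : 1 - D c = D (fun i => 1 - c i) := by
    have : diagonal (fun i => ((1 - c i : ℝ) : ℂ)) = 1 - diagonal (fun i => (c i : ℂ)) := by
      rw [← diagonal_one, diagonal_sub]
      simp
    simp only [D]
    rw [this, Matrix.mul_sub, Matrix.sub_mul, Matrix.mul_one, hU']
  have hWD : W = D hW.1.eigenvalues := by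
    conv_lhs => rw [hW.1.spectral_theorem]
    rfl
  have htr (c : n → ℝ) (X : Matrix n n ℂ) := trace_conj_diagonal_mul_re U X c
  have hdiag {X : Matrix n n ℂ} (hX : X.PosSemidef) (i : n) : 0 ≤ ((Uᴴ * X * U) i i).re :=
    (Complex.nonneg_iff.1 (hX.conjTranspose_mul_mul_same U).diag_nonneg).1
  set p : n → ℝ := fun i => ((Uᴴ * ρ * U) i i).re
  set q : n → ℝ := fun i => ((Uᴴ * α * U) i i).re
  -- Keep exactly the outcomes whose likelihood ratio `q/p` is at least `δ²`.
  let c : n → ℝ := fun i => if δ ^ 2 * p i ≤ q i then 1 else 0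
  have hcc (i : n) : c i * c i = c i := by simp [c]
  refine ⟨D c, hD c, by simp only [hDD, hcc], ?_, ?_⟩
  · have h1 := trace_projection_le hε hρ hα hd (hD fun i => 1 - c i)
      (by rw [hDD]; congr 1; ext i; linear_combination hcc i)
    have h2 : (D (fun i => 1 - c i) * α).trace.re ≤
        δ ^ 2 * (D (fun i => 1 - c i) * ρ).trace.re := by
      simp only [D, htr, Finset.mul_sum]
      refine Finset.sum_le_sum fun i _ => ?_
      by_cases h : δ ^ 2 * p i ≤ q i
      · simp [c, h]
      · simpa [c, h] using (not_le.1 h).le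
    have h3 : (D (fun i => 1 - c i) * ρ).trace.re = 1 - (D c * ρ).trace.re := by
      rw [← hD1, Matrix.sub_mul, Matrix.one_mul, trace_sub, hρ.2]; simp
    have h4 : 0 ≤ (D c * ρ).trace.re := by
      simp only [D, htr]
      refine Finset.sum_nonneg fun i _ => mul_nonneg ?_ (hdiag hρ.1 i)
      simp only [c]
      split_ifs <;> norm_num
    -- On the discarded outcomes `q < δ²p`, and `p` has total mass at most `1`.
    have h5 : √(D (fun i => 1 - c i) * α).trace.re ≤ δ := by
      refine Real.sqrt_le_iff.2 ⟨hδ.le, ?_⟩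
      nlinarith [sq_nonneg δ]
    linarith
  · rw [hWD, hDD, hDD]
    simp only [D, htr, Finset.mul_sum]
    refine Finset.sum_le_sum fun i _ => ?_
    have hw := hW.eigenvalues_nonneg i
    by_cases h : δ ^ 2 * p i ≤ q i
    · have := mul_le_mul_of_nonneg_left h hw
      simp only [c, h, if_true, one_mul, mul_one]
      linarith
    · simpa [c, h] using mul_nonneg hw (hdiag hα.1 i)

end Projection

/-! ### The compact convex set of states with fidelity witnesses -/

section Witnesses

variable {n : Type*} [Fintype n]

/-- The normalized states `τ` together with a matrix `V` witnessing that the square-root fidelity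
of `τ` with `S * S` is at least `r`. -/
def fidelityWitnesses (S : Matrix n n ℂ) (r : ℝ) : Set (Matrix n n ℂ × Matrix n n ℂ) :=
  {x | (x.2 - x.1 * x.1ᴴ).PosSemidef ∧ x.2.trace = 1 ∧ r ≤ (S * x.1).trace.re}

theorem convex_fidelityWitnesses (S : Matrix n n ℂ) (r : ℝ) :
    Convex ℝ (fidelityWitnesses S r) := by
  rintro ⟨V, τ⟩ ⟨h1, h2, h3⟩ ⟨V', τ'⟩ ⟨h1', h2', h3'⟩ s t hs ht hst
  simp only at h1 h2 h3 h1' h2' h3'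
  refine ⟨?_, ?_, ?_⟩
  · simp only [Prod.smul_mk, Prod.mk_add_mk]
    -- Operator convexity of `V ↦ VV*`, with its defect `st(V - V')(V - V')*` made explicit.
    have : s • τ + t • τ' - (s • V + t • V') * (s • V + t • V')ᴴ =
        s • (τ - V * Vᴴ) + t • (τ' - V' * V'ᴴ) + (s * t) • ((V - V') * (V - V')ᴴ) := by
      obtain rfl : t = 1 - s := by linarith
      simp only [conjTranspose_add, conjTranspose_sub, conjTranspose_smul, star_trivial,
        Matrix.add_mul, Matrix.mul_add, Matrix.sub_mul, Matrix.mul_sub, Matrix.smul_mul,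
        Matrix.mul_smul]
      module
    rw [this]
    exact ((h1.smul hs).add (h1'.smul ht)).add
      ((posSemidef_self_mul_conjTranspose _).smul (mul_nonneg hs ht))
  · simp only [Prod.smul_mk, Prod.mk_add_mk, trace_add, trace_smul, h2, h2']
    rw [← add_smul, hst, one_smul]
  · simp only [Prod.smul_mk, Prod.mk_add_mk, Matrix.mul_add, Matrix.mul_smul, trace_add,
      trace_smul, Complex.add_re, Complex.real_smul, Complex.re_ofReal_mul]
    calc r = s * r + t * r := by rw [← add_mul, hst, one_mul]
      _ ≤ _ := add_le_add (mul_le_mul_of_nonneg_left h3 hs) (mul_le_mul_of_nonneg_left h3' ht)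

theorem norm_entry_sq_le_trace (V : Matrix n n ℂ) (i j : n) :
    ‖V i j‖ ^ 2 ≤ (V * Vᴴ).trace.re := by
  have h : (V * Vᴴ).trace.re = ∑ i, ∑ j, ‖V i j‖ ^ 2 := by
    simp only [trace, diag, mul_apply, conjTranspose_apply, Complex.re_sum]
    refine Finset.sum_congr rfl fun i _ => Finset.sum_congr rfl fun j _ => ?_
    rw [RCLike.star_def, Complex.mul_conj, Complex.ofReal_re, Complex.normSq_eq_norm_sq]
  rw [h]
  exact (Finset.single_le_sum (f := fun j => ‖V i j‖ ^ 2) (fun _ _ => sq_nonneg _)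
    (Finset.mem_univ j)).trans (Finset.single_le_sum (f := fun i => ∑ j, ‖V i j‖ ^ 2)
      (fun _ _ => Finset.sum_nonneg fun _ _ => sq_nonneg _) (Finset.mem_univ i))

/-- Writing `τ = VV* + RR*` presents the set as a continuous image of pairs `(V, R)`. These form a
closed set, bounded because the squared Hilbert-Schmidt norms sum to `tr τ = 1`. -/
theorem isCompact_fidelityWitnesses (S : Matrix n n ℂ) (r : ℝ) :
    IsCompact (fidelityWitnesses S r) := by
  classical
  let K : Set (Matrix n n ℂ) :=
    Set.pi Set.univ fun _ => Set.pi Set.univ fun _ => Metric.closedBall (0 : ℂ) 1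
  have hK : IsCompact K :=
    isCompact_univ_pi fun _ => isCompact_univ_pi fun _ => isCompact_closedBall _ _
  let C : Set (Matrix n n ℂ × Matrix n n ℂ) :=
    {x | (x.1 * x.1ᴴ + x.2 * x.2ᴴ).trace = 1 ∧ r ≤ (S * x.1).trace.re}
  have hC : IsClosed C := by
    refine IsClosed.and (isClosed_eq ?_ continuous_const) (isClosed_le continuous_const ?_)
    · exact Continuous.matrix_trace (by fun_prop)
    · exact Complex.continuous_re.comp (Continuous.matrix_trace (by fun_prop))
  have hCK : C ⊆ K ×ˢ K := by
    rintro ⟨V, R⟩ ⟨h, -⟩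
    simp only [trace_add] at h
    have h' := congrArg Complex.re h
    rw [Complex.add_re, Complex.one_re] at h'
    have hV := trace_re_nonneg (posSemidef_self_mul_conjTranspose V)
    have hR := trace_re_nonneg (posSemidef_self_mul_conjTranspose R)
    have key (M : Matrix n n ℂ) (hM : (M * Mᴴ).trace.re ≤ 1) : M ∈ K := by
      refine fun i _ j _ => mem_closedBall_zero_iff.2 ?_
      have := (norm_entry_sq_le_trace M i j).trans hM
      exact (sq_le_one_iff₀ (norm_nonneg _)).1 this
    exact ⟨key V (by linarith), key R (by linarith)⟩
  have hCc : IsCompact C := (hK.prod hK).of_isClosed_subset hC hCK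
  have himage : fidelityWitnesses S r =
      (fun x : Matrix n n ℂ × Matrix n n ℂ => (x.1, x.1 * x.1ᴴ + x.2 * x.2ᴴ)) '' C := by
    ext ⟨V, τ⟩
    constructor
    · rintro ⟨h1, h2, h3⟩
      obtain ⟨R, hR⟩ := CStarAlgebra.nonneg_iff_eq_star_mul_self.mp h1.nonneg
      rw [star_eq_conjTranspose] at hR
      simp only at hR h2 h3
      have hτ : V * Vᴴ + Rᴴ * Rᴴᴴ = τ := by
        rw [conjTranspose_conjTranspose, ← hR, add_sub_cancel]
      exact ⟨(V, Rᴴ), ⟨by simp only [hτ, h2], h3⟩, by simp only [hτ]⟩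
    · rintro ⟨⟨V', R⟩, ⟨h1, h2⟩, h⟩
      obtain ⟨rfl, rfl⟩ := Prod.mk.inj h
      exact ⟨by simpa using posSemidef_self_mul_conjTranspose R, h1, h2⟩
  rw [himage]
  exact hCc.image (by fun_prop)

theorem posSemidef_of_mem_fidelityWitnesses {S V τ : Matrix n n ℂ} {r : ℝ}
    (h : (V, τ) ∈ fidelityWitnesses S r) : τ.PosSemidef := by
  have := h.1.add (posSemidef_self_mul_conjTranspose V)
  simpa using this

/-- Hermitian matrices are ordered by their expectations under positive semidefinite ones. -/
theorem le_of_forall_trace_mul_re_le {X Y : Matrix n n ℂ} (hX : X.IsHermitian)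
    (hY : Y.IsHermitian) (h : ∀ W : Matrix n n ℂ, W.PosSemidef →
      (W * X).trace.re ≤ (W * Y).trace.re) : X ≤ Y := by
  rw [le_iff]
  refine PosSemidef.of_dotProduct_mulVec_nonneg (hY.sub hX) fun x => ?_
  have h1 := h _ (posSemidef_vecMulVec_self_star x)
  have e (Z : Matrix n n ℂ) : (vecMulVec x (star x) * Z).trace = star x ⬝ᵥ Z *ᵥ x := by
    rw [vecMulVec_mul, trace_vecMulVec, dotProduct_comm, dotProduct_mulVec]
  rw [e, e] at h1
  refine Complex.nonneg_iff.2 ⟨?_, ?_⟩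
  · rw [sub_mulVec, dotProduct_sub, Complex.sub_re]
    linarith
  · exact ((hY.sub hX).im_star_dotProduct_mulVec_self x).symm

end Witnesses

/-! ### Joint smoothing of the two marginals -/

section JointSmoothing

variable {a b : Type*} [Fintype a] [DecidableEq a] [Fintype b] [DecidableEq b]

/-- Union bound for product projections. -/
theorem trace_kronecker_mul_re_ge {ρ : Matrix (a × b) (a × b) ℂ} (hρ : IsState ρ)
    {P : Matrix a a ℂ} {Q : Matrix b b ℂ} (hP : P.IsHermitian) (hPP : P * P = P)
    (hQ : Q.IsHermitian) (hQQ : Q * Q = Q) :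
    (P * marginalA ρ).trace.re + (Q * marginalB ρ).trace.re - 1 ≤
      ((P ⊗ₖ Q) * ρ).trace.re := by
  have h := trace_mul_re_nonneg ((posSemidef_one_sub_of_projection hP hPP).kronecker
    (posSemidef_one_sub_of_projection hQ hQQ)) hρ.1
  have e : (1 - P) ⊗ₖ (1 - Q) =
      1 - P ⊗ₖ (1 : Matrix b b ℂ) - (1 : Matrix a a ℂ) ⊗ₖ Q + P ⊗ₖ Q := by
    rw [← one_kronecker_one (α := ℂ) (m := a) (n := b)]
    ext ⟨i, j⟩ ⟨k, l⟩
    simp only [kroneckerMap_apply, Matrix.sub_apply, Matrix.add_apply]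
    ring
  rw [e, Matrix.add_mul, Matrix.sub_mul, Matrix.sub_mul, Matrix.one_mul, trace_add, trace_sub,
    trace_sub, hρ.2, ← trace_mul_marginalA, ← trace_mul_marginalB] at h
  simp only [Complex.add_re, Complex.sub_re, Complex.one_re] at h
  linarith

/-- Moving the projections onto the observable turns `W ⊗ 1` into `PWP ⊗ Q`, and `Q ≤ 1`. -/
theorem trace_mul_marginalA_conj_le {ρ : Matrix (a × b) (a × b) ℂ} (hρ : ρ.PosSemidef)
    {P W : Matrix a a ℂ} {Q : Matrix b b ℂ} (hP : P.IsHermitian) (hQ : Q.IsHermitian)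
    (hQQ : Q * Q = Q) (hW : W.PosSemidef) :
    (W * marginalA ((P ⊗ₖ Q) * ρ * (P ⊗ₖ Q))).trace.re ≤
      (P * W * P * marginalA ρ).trace.re := by
  have hPWP : (P * W * P).PosSemidef := by
    have := hW.mul_mul_conjTranspose_same P
    rwa [hP.eq] at this
  have e : ((W ⊗ₖ (1 : Matrix b b ℂ)) * ((P ⊗ₖ Q) * ρ * (P ⊗ₖ Q))).trace =
      (((P * W * P) ⊗ₖ Q) * ρ).trace := by
    rw [← Matrix.mul_assoc, trace_mul_comm, ← Matrix.mul_assoc, ← Matrix.mul_assoc,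
      ← mul_kronecker_mul, ← mul_kronecker_mul, Matrix.mul_one, hQQ]
  have h := trace_mul_re_nonneg (hPWP.kronecker (posSemidef_one_sub_of_projection hQ hQQ)) hρ
  rw [trace_mul_marginalA, trace_mul_marginalA, e]
  have e' : (P * W * P) ⊗ₖ (1 - Q) = (P * W * P) ⊗ₖ (1 : Matrix b b ℂ) - (P * W * P) ⊗ₖ Q := by
    ext ⟨i, j⟩ ⟨k, l⟩
    simp only [kroneckerMap_apply, Matrix.sub_apply]
    ring
  rw [e', Matrix.sub_mul, trace_sub, Complex.sub_re] at h
  linarith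

theorem trace_mul_marginalB_conj_le {ρ : Matrix (a × b) (a × b) ℂ} (hρ : ρ.PosSemidef)
    {P : Matrix a a ℂ} {Q W : Matrix b b ℂ} (hP : P.IsHermitian) (hPP : P * P = P)
    (hQ : Q.IsHermitian) (hW : W.PosSemidef) :
    (W * marginalB ((P ⊗ₖ Q) * ρ * (P ⊗ₖ Q))).trace.re ≤
      (Q * W * Q * marginalB ρ).trace.re := by
  have hQWQ : (Q * W * Q).PosSemidef := by
    have := hW.mul_mul_conjTranspose_same Q
    rwa [hQ.eq] at this
  have e : (((1 : Matrix a a ℂ) ⊗ₖ W) * ((P ⊗ₖ Q) * ρ * (P ⊗ₖ Q))).trace =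
      ((P ⊗ₖ (Q * W * Q)) * ρ).trace := by
    rw [← Matrix.mul_assoc, trace_mul_comm, ← Matrix.mul_assoc, ← Matrix.mul_assoc,
      ← mul_kronecker_mul, ← mul_kronecker_mul, Matrix.mul_one, hPP]
  have h := trace_mul_re_nonneg ((posSemidef_one_sub_of_projection hP hPP).kronecker hQWQ) hρ
  rw [trace_mul_marginalB, trace_mul_marginalB, e]
  have e' : (1 - P) ⊗ₖ (Q * W * Q) = (1 : Matrix a a ℂ) ⊗ₖ (Q * W * Q) - P ⊗ₖ (Q * W * Q) := by
    ext ⟨i, j⟩ ⟨k, l⟩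
    simp only [kroneckerMap_apply, Matrix.sub_apply]
    ring
  rw [e', Matrix.sub_mul, trace_sub, Complex.sub_re] at h
  linarith

variable {ρ : Matrix (a × b) (a × b) ℂ} {α : Matrix a a ℂ} {β : Matrix b b ℂ} {ε ε' δ : ℝ}

theorem isState_marginalA {a b : Type*} [Fintype a] [Fintype b]
    {ρ : Matrix (a × b) (a × b) ℂ} (hρ : IsState ρ) : IsState (marginalA ρ) :=
  ⟨posSemidef_marginalA hρ.1, (trace_marginalA ρ).trans hρ.2⟩

theorem isState_marginalB {a b : Type*} [Fintype a] [Fintype b]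
    {ρ : Matrix (a × b) (a × b) ℂ} (hρ : IsState ρ) : IsState (marginalB ρ) :=
  ⟨posSemidef_marginalB hρ.1, (trace_marginalB ρ).trans hρ.2⟩

/-- For fixed observables on the two marginals, a state close to `ρ` is obtained by projecting `ρ`
in the eigenbases of the observables. -/
theorem exists_fidelityWitness (hρ : IsState ρ) (hε : 0 ≤ ε) (hε' : 0 ≤ ε') (hδ : 0 < δ)
    (hsum : ε + ε' + 2 * δ < 1) (hα : α ∈ purifiedBall (√ε) (marginalA ρ))
    (hβ : β ∈ purifiedBall (√ε') (marginalB ρ)) {W : Matrix a a ℂ} {W' : Matrix b b ℂ}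
    (hW : W.PosSemidef) (hW' : W'.PosSemidef) :
    ∃ x ∈ fidelityWitnesses (CFC.sqrt ρ) √(1 - (ε + ε' + 2 * δ)),
      (W * marginalA x.2).trace.re ≤
        (δ ^ 2 * (1 - (ε + ε' + 2 * δ)))⁻¹ * (W * α).trace.re ∧
      (W' * marginalB x.2).trace.re ≤
        (δ ^ 2 * (1 - (ε + ε' + 2 * δ)))⁻¹ * (W' * β).trace.re := by
  obtain ⟨P, hP, hPP, hP1, hP2⟩ := exists_projection hε hδ (isState_marginalA hρ) hα.1 hα.2 hW
  obtain ⟨Q, hQ, hQQ, hQ1, hQ2⟩ := exists_projection hε' hδ (isState_marginalB hρ) hβ.1 hβ.2 hW'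
  have ht := trace_kronecker_mul_re_ge hρ hP hPP hQ hQQ
  have hA := trace_mul_marginalA_conj_le hρ.1 hP hQ hQQ hW
  have hB := trace_mul_marginalB_conj_le hρ.1 hP hPP hQ hW'
  set D := P ⊗ₖ Q with hDdef
  have hD : Dᴴ = D := by rw [hDdef, conjTranspose_kronecker, hP.eq, hQ.eq]
  have hDD : D * D = D := by rw [hDdef, ← mul_kronecker_mul, hPP, hQQ]
  set S := CFC.sqrt ρ with hSdef
  have hS : Sᴴ = S := (CFC.sqrt_nonneg ρ).posSemidef.isHermitian.eq
  have hSS : S * S = ρ := CFC.sqrt_mul_sqrt_self ρ hρ.1.nonneg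
  set t := (D * ρ).trace.re with htdef
  set κ := 1 - (ε + ε' + 2 * δ) with hκ
  have hκ0 : 0 < κ := by linarith
  have htκ : κ ≤ t := by linarith
  have ht0 : 0 < t := hκ0.trans_le htκ
  have hDρD : (D * ρ * D).trace = (t : ℂ) := by
    have h1 : (D * ρ * D).trace = (D * ρ).trace := by
      rw [trace_mul_comm, ← Matrix.mul_assoc, hDD]
    have h2 : 0 ≤ (D * ρ * D).trace := by
      have := (hρ.1.mul_mul_conjTranspose_same D).trace_nonneg
      rwa [hD] at this
    refine Complex.ext (by rw [h1, Complex.ofReal_re]) ?_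
    rw [Complex.ofReal_im]
    exact (Complex.nonneg_iff.1 h2).2.symm
  have hVV : ((√t)⁻¹ • (D * S)) * ((√t)⁻¹ • (D * S))ᴴ = t⁻¹ • (D * ρ * D) := by
    rw [conjTranspose_smul, star_trivial, Matrix.smul_mul, Matrix.mul_smul, smul_smul,
      conjTranspose_mul, hS, hD, ← mul_inv, Real.mul_self_sqrt ht0.le, ← hSS]
    simp only [Matrix.mul_assoc]
  have bound {u v w : ℝ} (huv : u ≤ v) (hvw : δ ^ 2 * v ≤ w) (hw : 0 ≤ w) :
      t⁻¹ * u ≤ (δ ^ 2 * κ)⁻¹ * w := by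
    have hδ2 : 0 < δ ^ 2 := by positivity
    have h1 : u ≤ (δ ^ 2)⁻¹ * w := by
      rw [inv_mul_eq_div, le_div_iff₀ hδ2]
      linarith [mul_le_mul_of_nonneg_left huv hδ2.le]
    calc t⁻¹ * u ≤ t⁻¹ * ((δ ^ 2)⁻¹ * w) := by gcongr
      _ ≤ κ⁻¹ * ((δ ^ 2)⁻¹ * w) := by gcongr
      _ = _ := by rw [mul_inv]; ring
  have smulA (X : Matrix (a × b) (a × b) ℂ) : marginalA (t⁻¹ • X) = t⁻¹ • marginalA X := by
    simpa using marginalA_combo t⁻¹ 0 X 0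
  have smulB (X : Matrix (a × b) (a × b) ℂ) : marginalB (t⁻¹ • X) = t⁻¹ • marginalB X := by
    simpa using marginalB_combo t⁻¹ 0 X 0
  -- Here `VV* = τ` exactly, and `tr(SV) = t/√t = √t`.
  refine ⟨((√t)⁻¹ • (D * S), t⁻¹ • (D * ρ * D)), ⟨?_, ?_, ?_⟩, ?_, ?_⟩
  · simp only [hVV, sub_self, PosSemidef.zero]
  · simp only [trace_smul, hDρD, Complex.real_smul]
    rw [← Complex.ofReal_mul, inv_mul_cancel₀ ht0.ne', Complex.ofReal_one]
  · simp only [Matrix.mul_smul, trace_smul, Complex.real_smul, Complex.re_ofReal_mul]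
    have : (S * (D * S)).trace = (D * ρ).trace := by
      rw [trace_mul_comm, Matrix.mul_assoc, hSS]
    rw [this, ← htdef, inv_mul_eq_div, Real.div_sqrt]
    exact Real.sqrt_le_sqrt htκ
  · simp only [smulA, Matrix.mul_smul, trace_smul, Complex.real_smul, Complex.re_ofReal_mul]
    exact bound hA hP2 (trace_mul_re_nonneg hW hα.1.1)
  · simp only [smulB, Matrix.mul_smul, trace_smul, Complex.real_smul, Complex.re_ofReal_mul]
    exact bound hB hQ2 (trace_mul_re_nonneg hW' hβ.1.1)

theorem convex_posSemidef {n : Type*} : Convex ℝ {W : Matrix n n ℂ | W.PosSemidef} :=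
  fun _ hX _ hY _ _ hs ht _ => (hX.smul hs).add (hY.smul ht)

/-- Joint smoothing: states close to the marginals of `ρ` bound, up to a constant, the marginals
of a single state close to `ρ`. -/
theorem exists_state_marginals_le (hρ : IsState ρ) (hε : 0 ≤ ε) (hε' : 0 ≤ ε') (hδ : 0 < δ)
    (hsum : ε + ε' + 2 * δ < 1) (hα : α ∈ purifiedBall (√ε) (marginalA ρ))
    (hβ : β ∈ purifiedBall (√ε') (marginalB ρ)) :
    ∃ τ, IsState τ ∧ purifiedDist ρ τ ≤ √(ε + ε' + 2 * δ) ∧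
      marginalA τ ≤ (δ ^ 2 * (1 - (ε + ε' + 2 * δ)))⁻¹ • α ∧
      marginalB τ ≤ (δ ^ 2 * (1 - (ε + ε' + 2 * δ)))⁻¹ • β := by
  set k := (δ ^ 2 * (1 - (ε + ε' + 2 * δ)))⁻¹ with hk
  let f (x : Matrix (a × b) (a × b) ℂ × Matrix (a × b) (a × b) ℂ)
      (y : Matrix a a ℂ × Matrix b b ℂ) : ℝ :=
    (y.1 * (marginalA x.2 - k • α)).trace.re + (y.2 * (marginalB x.2 - k • β)).trace.re
  -- The whole cone of test pairs is admissible, since only the witness set has to be compact.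
  let Y : Set (Matrix a a ℂ × Matrix b b ℂ) := {W | W.PosSemidef} ×ˢ {W | W.PosSemidef}
  have hf1 (x) : Continuous (f x) :=
    (Complex.continuous_re.comp (Continuous.matrix_trace (by fun_prop))).add
      (Complex.continuous_re.comp (Continuous.matrix_trace (by fun_prop)))
  have hf2 (y) : Continuous fun x => f x y := by
    have h1 : Continuous fun x : Matrix (a × b) (a × b) ℂ × Matrix (a × b) (a × b) ℂ =>
      marginalA x.2 := continuous_marginalA.comp continuous_snd
    have h2 : Continuous fun x : Matrix (a × b) (a × b) ℂ × Matrix (a × b) (a × b) ℂ =>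
      marginalB x.2 := continuous_marginalB.comp continuous_snd
    exact (Complex.continuous_re.comp (Continuous.matrix_trace (by fun_prop))).add
      (Complex.continuous_re.comp (Continuous.matrix_trace (by fun_prop)))
  have hY : Convex ℝ Y := convex_posSemidef.prod convex_posSemidef
  have hX := convex_fidelityWitnesses (CFC.sqrt ρ) √(1 - (ε + ε' + 2 * δ))
  obtain ⟨⟨V, τ⟩, hx, hle⟩ := exists_forall_le_of_forall_exists_le (f := f) (Y := Y) (t := 0)
    ⟨0, PosSemidef.zero, PosSemidef.zero⟩ hX (isCompact_fidelityWitnesses _ _) hY hf1 hf2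
    (fun x _ => ⟨hY, fun y _ y' _ s t _ _ _ => le_of_eq (by
      simp only [f, Prod.fst_add, Prod.snd_add, Prod.smul_fst, Prod.smul_snd, Matrix.add_mul,
        Matrix.smul_mul, trace_add, trace_smul, Complex.add_re, Complex.real_smul,
        Complex.re_ofReal_mul, smul_eq_mul]
      ring)⟩)
    (fun y _ => ⟨hX, fun x _ x' _ s t _ _ hst => le_of_eq (by
      obtain rfl : t = 1 - s := by linarith
      simp only [f, Prod.snd_add, Prod.smul_snd, marginalA_combo, marginalB_combo,
        Matrix.mul_sub, Matrix.mul_add, Matrix.mul_smul, trace_add, trace_sub, trace_smul,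
        Complex.add_re, Complex.sub_re, Complex.real_smul, Complex.re_ofReal_mul, smul_eq_mul]
      ring)⟩)
    (fun y hy => by
      obtain ⟨x, hx, h1, h2⟩ := exists_fidelityWitness hρ hε hε' hδ hsum hα hβ hy.1 hy.2
      refine ⟨x, hx, ?_⟩
      simp only [f, Matrix.mul_sub, Matrix.mul_smul, trace_sub, trace_smul, Complex.sub_re,
        Complex.real_smul, Complex.re_ofReal_mul]
      linarith)
  have hτ := posSemidef_of_mem_fidelityWitnesses hx
  have hη : 0 ≤ ε + ε' + 2 * δ := by linarith
  refine ⟨τ, ⟨hτ, hx.2.1⟩, ?_, ?_, ?_⟩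
  · rw [purifiedDist_le_sqrt_iff hρ.2 hη, ← Real.sqrt_le_left (traceNorm_nonneg _)]
    exact hx.2.2.trans (trace_sqrt_mul_re_le_traceNorm hτ hx.1)
  · refine le_of_forall_trace_mul_re_le (posSemidef_marginalA hτ).isHermitian
      (hα.1.1.isHermitian.smul (IsSelfAdjoint.all k)) fun W hW => ?_
    -- The payoff only controls a sum; a zero test operator on the other side isolates one marginal.
    have := hle (W, 0) ⟨hW, PosSemidef.zero⟩
    simp only [f, Matrix.mul_sub, trace_sub, Complex.sub_re, Matrix.zero_mul, trace_zero,
      Complex.zero_re] at this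
    linarith
  · refine le_of_forall_trace_mul_re_le (posSemidef_marginalB hτ).isHermitian
      (hβ.1.1.isHermitian.smul (IsSelfAdjoint.all k)) fun W hW => ?_
    have := hle (0, W) ⟨PosSemidef.zero, hW⟩
    simp only [f, Matrix.mul_sub, trace_sub, Complex.sub_re, Matrix.zero_mul, trace_zero,
      Complex.zero_re] at this
    linarith

end JointSmoothing

/-! ### From operator inequalities to smooth max-divergences -/

section SmoothMaxDivergence

variable {n : Type*} [Fintype n] [DecidableEq n] {ρ α σ : Matrix n n ℂ} {ε : ℝ}

theorem dMax_le_coe {n : Type*} {α σ : Matrix n n ℂ} {l : ℝ} (h : α ≤ ((2 : ℝ) ^ l) • σ) : dMax α σ ≤ l :=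
  iInf₂_le l h

theorem self_mem_purifiedBall (hρ : IsState ρ) (hε : 0 ≤ ε) : ρ ∈ purifiedBall (√ε) ρ := by
  refine ⟨⟨hρ.1, by simp [hρ.2], by simp [hρ.2]⟩, (purifiedDist_le_sqrt_iff hρ.2 hε).2 ?_⟩
  have hS : (CFC.sqrt ρ)ᴴ = CFC.sqrt ρ := (CFC.sqrt_nonneg ρ).posSemidef.isHermitian.eq
  have hSS := CFC.sqrt_mul_sqrt_self ρ hρ.1.nonneg
  have h := trace_sqrt_mul_re_le_traceNorm (ρ := ρ) (V := CFC.sqrt ρ) hρ.1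
    (by rw [hS, hSS, sub_self]; exact PosSemidef.zero)
  nth_rw 1 [hSS] at h
  rw [hρ.2, Complex.one_re] at h
  nlinarith

/-- The trivial measurement gives `‖√ρ√α‖₁ ≤ √(tr α)`. -/
theorem one_sub_le_trace_of_mem_purifiedBall (hρ : IsState ρ) (hε : 0 ≤ ε)
    (hα : α ∈ purifiedBall (√ε) ρ) : 1 - ε ≤ α.trace.re := by
  have h := traceNorm_sqrt_mul_sqrt_le hρ.1 hα.1.1 isHermitian_one (Matrix.one_mul 1)
  simp only [sub_self, Matrix.zero_mul, trace_zero, Complex.zero_re,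
    Real.sqrt_zero, mul_zero, add_zero, hρ.2, Complex.one_re, Real.sqrt_one, one_mul] at h
  refine ((purifiedDist_le_sqrt_iff hρ.2 hε).1 hα.2).trans ?_
  calc _ ≤ √α.trace.re ^ 2 := pow_le_pow_left₀ (traceNorm_nonneg _) h 2
    _ = α.trace.re := Real.sq_sqrt hα.1.2.1.le

/-- Taking traces, every feasible exponent satisfies `2^l tr σ ≥ tr α ≥ 1 - ε > 0`, a lower bound
uniform over the ball. Finiteness is what permits the choice of a near-optimal `α`. -/
theorem smoothDMax_ne_bot (hρ : IsState ρ) (hε : 0 ≤ ε) (hε1 : ε < 1) :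
    smoothDMax (√ε) ρ σ ≠ ⊥ := by
  refine ne_bot_of_le_ne_bot (EReal.coe_ne_bot (Real.logb 2 ((1 - ε) / σ.trace.re))) ?_
  refine le_iInf₂ fun α hα => le_iInf₂ fun l hl => EReal.coe_le_coe_iff.2 ?_
  have h1 := one_sub_le_trace_of_mem_purifiedBall hρ hε hα
  have h2 := trace_re_nonneg (le_iff.1 hl)
  rw [trace_sub, trace_smul, Complex.sub_re, Complex.real_smul, Complex.re_ofReal_mul] at h2
  have hl0 : (0 : ℝ) < 2 ^ l := Real.rpow_pos_of_pos two_pos l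
  have h3 : 0 < (2 : ℝ) ^ l * σ.trace.re := by linarith
  have hσ : 0 < σ.trace.re := pos_of_mul_pos_right h3 hl0.le
  rw [Real.logb_le_iff_le_rpow one_lt_two (div_pos (by linarith) hσ), div_le_iff₀ hσ]
  linarith

/-- A near-optimal state for the smooth max-divergence transfers its bound to all operators it
dominates up to a factor. -/
theorem exists_forall_dMax_le (hρ : IsState ρ) (hε : 0 ≤ ε) (hε1 : ε < 1) :
    ∃ α ∈ purifiedBall (√ε) ρ, ∀ κ c : ℝ, 0 < κ → Real.logb 2 κ + 1 ≤ c →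
      ∀ X : Matrix n n ℂ, X ≤ κ • α → dMax X σ ≤ smoothDMax (√ε) ρ σ + (c : EReal) := by
  by_cases htop : smoothDMax (√ε) ρ σ = ⊤
  · refine ⟨ρ, self_mem_purifiedBall hρ hε, fun κ c _ _ X _ => ?_⟩
    rw [htop, EReal.top_add_coe]
    exact le_top
  have hbot := smoothDMax_ne_bot (σ := σ) hρ hε hε1
  obtain ⟨s, hs⟩ : ∃ s : ℝ, smoothDMax (√ε) ρ σ = s := ⟨_, (EReal.coe_toReal htop hbot).symm⟩
  -- Attainment of the infimum is not needed: one unit of slack is paid for by the `+ 1` in the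
  -- condition on `c`.
  have hlt : smoothDMax (√ε) ρ σ < ((s + 1 : ℝ) : EReal) := by
    rw [hs, EReal.coe_lt_coe_iff]
    exact lt_add_one s
  simp only [smoothDMax, dMax, iInf_lt_iff] at hlt
  obtain ⟨α, hα, l, hl, hls⟩ := hlt
  refine ⟨α, hα, fun κ c hκ hc X hX => ?_⟩
  rw [EReal.coe_lt_coe_iff] at hls
  have h1 : X ≤ ((2 : ℝ) ^ (Real.logb 2 κ + l)) • σ := by
    rw [Real.rpow_add two_pos, Real.rpow_logb two_pos (by norm_num) hκ, mul_smul]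
    refine hX.trans (le_iff.2 ?_)
    rw [← smul_sub]
    exact (le_iff.1 hl).smul hκ.le
  refine (dMax_le_coe h1).trans ?_
  rw [hs, ← EReal.coe_add, EReal.coe_le_coe_iff]
  linarith

end SmoothMaxDivergence

end OneShot

theorem mainTheorem4 {a b : Type*} [Fintype a] [DecidableEq a] [Fintype b] [DecidableEq b]
    (ρ : Matrix (a × b) (a × b) ℂ) (hρ : OneShot.IsState ρ)
    (σA : Matrix a a ℂ) (hσA : σA.PosSemidef)
    (σB : Matrix b b ℂ) (hσB : σB.PosSemidef)
    (ε ε' δ : ℝ) (hε : ε ∈ Set.Ioo (0 : ℝ) 1) (hε' : ε' ∈ Set.Ioo (0 : ℝ) 1)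
    (hδ : δ ∈ Set.Ioo (0 : ℝ) 1) (hsum : ε + ε' + 2 * δ < 1) :
    ∃ τ : Matrix (a × b) (a × b) ℂ, OneShot.IsState τ ∧
      OneShot.purifiedDist ρ τ ≤ Real.sqrt (ε + ε' + 2 * δ) ∧
      OneShot.dMax (OneShot.marginalA τ) σA ≤
        OneShot.smoothDMax (Real.sqrt ε) (OneShot.marginalA ρ) σA +
          ((2 - 2 * Real.logb 2 δ - Real.logb 2 (1 - ε - ε' - 2 * δ) : ℝ) : EReal) ∧
      OneShot.dMax (OneShot.marginalB τ) σB ≤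
        OneShot.smoothDMax (Real.sqrt ε') (OneShot.marginalB ρ) σB +
          ((2 - 2 * Real.logb 2 δ - Real.logb 2 (1 - ε - ε' - 2 * δ) : ℝ) : EReal) := by
  obtain ⟨α, hα, hA⟩ :=
    OneShot.exists_forall_dMax_le (σ := σA) (OneShot.isState_marginalA hρ) hε.1.le hε.2
  obtain ⟨β, hβ, hB⟩ :=
    OneShot.exists_forall_dMax_le (σ := σB) (OneShot.isState_marginalB hρ) hε'.1.le hε'.2
  obtain ⟨τ, hτ, hd, hτA, hτB⟩ :=
    OneShot.exists_state_marginals_le hρ hε.1.le hε'.1.le hδ.1 hsum hα hβ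
  have hδ0 := hδ.1
  have hη : 0 < 1 - (ε + ε' + 2 * δ) := by linarith
  have hκ : 0 < (δ ^ 2 * (1 - (ε + ε' + 2 * δ)))⁻¹ := by positivity
  -- `log k = -2 log δ - log(1 - η)`; of the constant `2`, one unit pays for near-optimality and the
  -- other is spare.
  have hc : Real.logb 2 (δ ^ 2 * (1 - (ε + ε' + 2 * δ)))⁻¹ + 1 ≤
      2 - 2 * Real.logb 2 δ - Real.logb 2 (1 - ε - ε' - 2 * δ) := by
    rw [Real.logb_inv, Real.logb_mul (by positivity) hη.ne', Real.logb_pow,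
      show 1 - (ε + ε' + 2 * δ) = 1 - ε - ε' - 2 * δ by ring]
    push_cast
    linarith
  exact ⟨τ, hτ, hd, hA _ _ hκ hc _ hτA, hB _ _ hκ hc _ hτB⟩
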